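/- **Definitions.** Matrices of size $n_1n_2\cdots n_d$ are indexed lexicographically by multi-indices $\mathbf i=(i_1,\dots,i_d)$, $1\le i_l\le n_l$, and partitioned into $n_1\times n_1$ blocks $B_{i,j}$ of size $n_2\cdots n_d$. Such a matrix is *$d$-level banded* with bandwidths $(b_1,\dots,b_d)$ if $B_{i,j}=0$ whenever $|i-j|>b_1$ and, for $d\ge2$, every block $B_{i,j}$ is $(d-1)$-level banded with bandwidths $(b_2,\dots,b_d)$. For $d=1$ let $\mathcal S_{(n_1)}$ and $\mathcal S^+_{(n_1)}$ be the sets of symmetric positive semidefinite and symmetric positive definite real $n_1\times n_1$ matrices. For $d\ge 2$ let $\mathcal S_{(n_1,\dots,n_d)}$ (respectively $\mathcal S^+_{(n_1,\dots,n_d)}$) be the set of symmetric positive semidefinite (respectively definite) matrices all of whose blocks satisfy $B_{i,j}\in\mathcal S_{(n_2,\dots,n_d)}$. For each direction $l=1,\dots,d$ let $\Xi_l=(\xi_{l,1}\le\dots\le\xi_{l,N_l+p_l+1})$ be an open knot vector on $[0,1]$: the first $p_l+1$ knots are $0$, the last $p_l+1$ knots are $1$, and $\xi_{l,i}<\xi_{l,i+p_l+1}$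 for $1\le i\le N_l$ (no knot is repeated more than $p_l+1$ times). Let $\hat B_{l,1},\dots,\hat B_{l,N_l}$ be the corresponding B-splines of degree $p_l$, and $\hat B_{\mathbf i}(\hat{\mathbf x})=\prod_{l}\hat B_{l,i_l}(\hat x_l)$. For positive weights $w_{\mathbf i}$ the NURBS basis functions are $\hat R_{\mathbf i}=w_{\mathbf i}\hat B_{\mathbf i}/\sum_{\mathbf j}w_{\mathbf j}\hat B_{\mathbf j}$. In each direction keep $n_l$ consecutive indices (all $N_l$ of them, or fewer, for instance without the first or last one in order to impose homogeneous Dirichlet conditions), and let $\mathbf n=(n_1,\dots,n_d)$, $\mathbf p=(p_1,\dots,p_d)$. Let $\hat\Omega=(0,1)^d$, let $F:\hat\Omega\to\mathbb R^d$ be a geometry map whose Jacobian matrix $J_F$ exists and is invertible almost everywhere in $\hat\Omega$, let $\rho>0$ be a density on $F(\hat\Omega)$, and assume that $c=(\rho\circ F)\,|\det J_F|$ is integrable on $\hat\Omega$. The single-patch mass matrix of a family $(\phi_{\mathbf i})$ of functions on $\hat\Omega$, indexed by the kept multi-indices, is $$\mathcal M_{\mathbf i\mathbf j}=\int_{\hat\Omega}c(\hat{\mathbf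 x})\,\phi_{\mathbf i}(\hat{\mathbf x})\,\phi_{\mathbf j}(\hat{\mathbf x})\,d\hat{\mathbf x}.$$ **Lemma.** 1. If $\phi_{\mathbf i}=\hat B_{\mathbf i}$ (B-splines), then $\mathcal M$ is $d$-level banded with bandwidths $\mathbf p$ and $\mathcal M\in\mathcal S^+_{\mathbf n}$. 2. If $\phi_{\mathbf i}=\hat R_{\mathbf i}$ (NURBS, arbitrary positive weights), then $\mathcal M$ is $d$-level banded with bandwidths $\mathbf p$ and symmetric positive definite. If moreover the weights have tensor-product form $w_{\mathbf i}=\prod_l u_{l,i_l}$, then $\mathcal M\in\mathcal S^+_{\mathbf n}$. -/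

import Mathlib

open MeasureTheory

noncomputable section

/-- Multi-indices `(i_1, …, i_d)` with `i_l` ranging over `n_l` values (counted from `0`). They are
the row and column labels of matrices of size `n_1 n_2 ⋯ n_d`. -/
abbrev MultiIndex {d : ℕ} (n : Fin d → ℕ) : Type := (l : Fin d) → Fin (n l)

/-- The block `B_{i,j}`, of size `n_2 ⋯ n_d`, of a matrix of size `n_1 n_2 ⋯ n_d` (lexicographic
labelling): its `(r, s)` entry is the `((i, r), (j, s))` entry of `B`. -/
def matrixBlock {d : ℕ} {n : Fin (d + 1) → ℕ}
    (B : Matrix (MultiIndex n) (MultiIndex n) ℝ) (i j : Fin (n 0)) :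
    Matrix (MultiIndex fun l : Fin d => n l.succ) (MultiIndex fun l : Fin d => n l.succ) ℝ :=
  Matrix.of fun r s =>
    B (Fin.cons (α := fun l => Fin (n l)) i r) (Fin.cons (α := fun l => Fin (n l)) j s)

/-- `d`-level banded matrices with bandwidths `(b_1, …, b_d)`. In the innermost level the blocks are
scalars, on which there is no condition; so `d = 1` is the usual notion of a banded matrix. -/
def IsLevelBanded : {d : ℕ} → (n b : Fin d → ℕ) → Matrix (MultiIndex n) (MultiIndex n) ℝ → Prop
  | 0, _, _, _ => True
  | _ + 1, n, b, B => ∀ i j : Fin (n 0),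
      (((b 0 : ℕ) : ℤ) < |((i : ℕ) : ℤ) - ((j : ℕ) : ℤ)| → matrixBlock B i j = 0) ∧
      IsLevelBanded (fun l => n l.succ) (fun l => b l.succ) (matrixBlock B i j)

/-- The set `𝒮_(n_1, …, n_d)`: symmetric positive semidefinite matrices, for `d ≥ 2` with all blocks
`B_{i,j}` in `𝒮_(n_2, …, n_d)`. (`Matrix.PosSemidef` includes symmetry.) -/
def IsHierSPSD : {d : ℕ} → (n : Fin d → ℕ) → Matrix (MultiIndex n) (MultiIndex n) ℝ → Prop
  | 0, _, B => B.PosSemidef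
  | 1, _, B => B.PosSemidef
  | _ + 2, n, B => B.PosSemidef ∧
      ∀ i j : Fin (n 0), IsHierSPSD (fun l => n l.succ) (matrixBlock B i j)

/-- The set `𝒮⁺_(n_1, …, n_d)`: symmetric positive definite matrices, for `d ≥ 2` with all blocks
`B_{i,j}` in `𝒮_(n_2, …, n_d)`. (`Matrix.PosDef` includes symmetry.) -/
def IsHierSPD : {d : ℕ} → (n : Fin d → ℕ) → Matrix (MultiIndex n) (MultiIndex n) ℝ → Prop
  | 0, _, B => B.PosDef
  | 1, _, B => B.PosDef
  | _ + 2, n, B => B.PosDef ∧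
      ∀ i j : Fin (n 0), IsHierSPSD (fun l => n l.succ) (matrixBlock B i j)

/-- `ξ 0 ≤ … ≤ ξ (N + p)` is an open knot vector on `[0, 1]` for degree `p` and dimension `N`:
the first `p + 1` knots are `0`, the last `p + 1` knots are `1`, and no value is repeated more than
`p + 1` times. Entries of `ξ` beyond `N + p` play no role. -/
structure IsOpenKnotVector (p N : ℕ) (ξ : ℕ → ℝ) : Prop where
  mono : ∀ i j, i ≤ j → j ≤ N + p → ξ i ≤ ξ j
  left : ∀ i, i ≤ p → ξ i = 0
  right : ∀ i, N ≤ i → i ≤ N + p → ξ i = 1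
  mult : ∀ i, i < N → ξ i < ξ (i + p + 1)

/-- The `i`-th univariate B-spline of degree `p` on the knots `ξ`, by the Cox–de Boor recursion;
a quotient with zero denominator is read as `0`. -/
def bspline (ξ : ℕ → ℝ) : ℕ → ℕ → ℝ → ℝ
  | 0, i, x => if ξ i ≤ x ∧ x < ξ (i + 1) then 1 else 0
  | p + 1, i, x =>
      (x - ξ i) / (ξ (i + p + 1) - ξ i) * bspline ξ p i x +
        (ξ (i + p + 2) - x) / (ξ (i + p + 2) - ξ (i + 1)) * bspline ξ p (i + 1) x

/-- The tensor-product B-spline with multi-index `i`. -/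
def tensorBSpline {d : ℕ} (p : Fin d → ℕ) (ξ : Fin d → ℕ → ℝ) {N : Fin d → ℕ}
    (i : MultiIndex N) (x : Fin d → ℝ) : ℝ :=
  ∏ l, bspline (ξ l) (p l) (i l) (x l)

/-- The NURBS basis function with multi-index `i` and weights `w`. -/
def nurbs {d : ℕ} (p : Fin d → ℕ) (ξ : Fin d → ℕ → ℝ) {N : Fin d → ℕ}
    (w : MultiIndex N → ℝ) (i : MultiIndex N) (x : Fin d → ℝ) : ℝ :=
  w i * tensorBSpline p ξ i x / ∑ j : MultiIndex N, w j * tensorBSpline p ξ j x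

/-- The embedding of multi-indices obtained by keeping, in each direction `l`, only the `n l`
consecutive univariate functions starting with number `a l`. (All of them if `a = 0`, `n = N`;
dropping the first or the last ones imposes homogeneous Dirichlet conditions on a face.) -/
def keptIndex {d : ℕ} {N a n : Fin d → ℕ} (h : ∀ l, a l + n l ≤ N l) (i : MultiIndex n) :
    MultiIndex N :=
  fun l => ⟨a l + i l, lt_of_lt_of_le (Nat.add_lt_add_left (i l).isLt (a l)) (h l)⟩

/-- The parametric domain `(0, 1)^d`. -/
def paramDomain (d : ℕ) : Set (Fin d → ℝ) := Set.univ.pi fun _ => Set.Ioo 0 1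

/-- The coefficient `c = (ρ ∘ F) |det J_F|` of the mass matrix. -/
def massCoeff {d : ℕ} (ρ : (Fin d → ℝ) → ℝ) (F : (Fin d → ℝ) → (Fin d → ℝ))
    (x : Fin d → ℝ) : ℝ :=
  ρ (F x) * |(fderiv ℝ F x).det|

/-- The mass matrix of the functions `φ i ∘ F⁻¹` on the physical domain, written on the parametric
domain: its entries are `∫_{(0,1)^d} c φ_i φ_j`. -/
def massMatrix {d : ℕ} {ι : Type} (ρ : (Fin d → ℝ) → ℝ) (F : (Fin d → ℝ) → (Fin d → ℝ))
    (φ : ι → (Fin d → ℝ) → ℝ) : Matrix ι ι ℝ :=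
  Matrix.of fun i j => ∫ x in paramDomain d, massCoeff ρ F x * φ i x * φ j x

end

/-! ### Univariate B-splines: support, sign, bounds, regularity -/

section
variable {ξ : ℕ → ℝ} {M : ℕ}

/-! The mass matrix is the Gram matrix of the basis for the density `c`, positive almost everywhere.
Its quadratic form is `∫ c (∑ v_i φ_i)²`, so definiteness reduces to linear independence up to null
sets (`posDef_weightedGram`). Bandedness is disjointness of supports.

For the block structure, write the basis functions as products. Fixing the first indices `i`, `j`
moves the factor `f_i f_j` into the density, and the block is a Gram matrix of the remaining
products (`matrixBlock_weightedGram_prod`). Since the factors are nonnegative, so is the new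
density, and induction on the number of directions applies. No product structure of `c` is used.

Univariate independence comes from orders of vanishing. Take the least `i` with nonzero coefficient
and let `m` knots of `B_i` sit at its left end `t`. To the right of `t`, `B_i` is at least a
multiple of `(x - t)^(p+1-m)`, while every later B-spline has fewer knots at `t` and is smaller by a
factor `x - t` (`exists_mul_pow_le_bspline`, `exists_bspline_le_mul_pow`). Hence the combination
cannot vanish near `t`. Independence passes to tensor products one variable at a time, and to NURBS
by clearing the common denominator. -/

theorem IsOpenKnotVector.monotoneOn {p N : ℕ} (h : IsOpenKnotVector p N ξ) :
    MonotoneOn ξ (Set.Iic (N + p)) :=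
  fun _ _ _ hj hij => h.mono _ _ hij hj

theorem bspline_eq_zero_of_notMem (hξ : MonotoneOn ξ (Set.Iic M)) {p i : ℕ} (hi : i + p + 1 ≤ M)
    {x : ℝ} (hx : x < ξ i ∨ ξ (i + p + 1) ≤ x) : bspline ξ p i x = 0 := by
  induction p generalizing i with
  | zero =>
    rw [bspline, if_neg]
    rintro ⟨h1, h2⟩
    rcases hx with h | h
    · exact absurd h1 (not_le.2 h)
    · exact absurd h2 (not_lt.2 h)
  | succ p ih =>
    have h1 : ξ i ≤ ξ (i + 1) := hξ (Set.mem_Iic.2 (by omega)) (Set.mem_Iic.2 (by omega)) (by omega)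
    have h2 : ξ (i + p + 1) ≤ ξ (i + (p + 1) + 1) :=
      hξ (Set.mem_Iic.2 (by omega)) (Set.mem_Iic.2 (by omega)) (by omega)
    have h3 : i + 1 + p + 1 = i + (p + 1) + 1 := by omega
    rw [bspline, ih (by omega) (hx.imp id fun h => h2.trans h),
      ih (by omega) (hx.imp (fun h => h.trans_le h1) fun h => by rwa [h3])]
    simp

theorem bspline_nonneg (hξ : MonotoneOn ξ (Set.Iic M)) {p i : ℕ} (hi : i + p + 1 ≤ M) (x : ℝ) :
    0 ≤ bspline ξ p i x := by
  induction p generalizing i with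
  | zero => rw [bspline]; split_ifs <;> norm_num
  | succ p ih =>
    by_cases hx : x < ξ i ∨ ξ (i + (p + 1) + 1) ≤ x
    · rw [bspline_eq_zero_of_notMem hξ hi hx]
    · push Not at hx
      have h1 : ξ i ≤ ξ (i + p + 1) :=
        hξ (Set.mem_Iic.2 (by omega)) (Set.mem_Iic.2 (by omega)) (by omega)
      have h2 : ξ (i + 1) ≤ ξ (i + p + 2) :=
        hξ (Set.mem_Iic.2 (by omega)) (Set.mem_Iic.2 (by omega)) (by omega)
      rw [bspline]
      exact add_nonneg
        (mul_nonneg (div_nonneg (sub_nonneg.2 hx.1) (sub_nonneg.2 h1)) (ih (by omega)))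
        (mul_nonneg (div_nonneg (sub_nonneg.2 hx.2.le) (sub_nonneg.2 h2)) (ih (by omega)))

/-- Each ratio in the recursion is at most one on the support of the spline it multiplies, so the
bound at most doubles per degree. This crude bound suffices for integrability and makes the
partition of unity unnecessary. -/
theorem bspline_le_two_pow (hξ : MonotoneOn ξ (Set.Iic M)) {p i : ℕ} (hi : i + p + 1 ≤ M)
    (x : ℝ) : bspline ξ p i x ≤ 2 ^ p := by
  induction p generalizing i with
  | zero => rw [bspline]; split_ifs <;> norm_num
  | succ p ih =>
    have key : ∀ {r b : ℝ}, (b ≠ 0 → r ≤ 1) → 0 ≤ b → b ≤ 2 ^ p → r * b ≤ 2 ^ p := by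
      intro r b hr hb hb'
      rcases eq_or_ne b 0 with rfl | h
      · simp
      · exact (mul_le_of_le_one_left hb (hr h)).trans hb'
    rw [bspline, pow_succ, mul_two]
    refine add_le_add (key (fun h => ?_) (bspline_nonneg hξ (by omega) x) (ih (by omega)))
      (key (fun h => ?_) (bspline_nonneg hξ (by omega) x) (ih (by omega)))
    · have := mt (bspline_eq_zero_of_notMem hξ (by omega)) h
      push Not at this
      exact div_le_one_of_le₀ (by linarith) (by linarith)
    · have := mt (bspline_eq_zero_of_notMem hξ (by omega)) h
      push Not at this
      have e : i + 1 + p + 1 = i + p + 2 := by omega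
      rw [e] at this
      exact div_le_one_of_le₀ (by linarith) (by linarith)

theorem bspline_mul_bspline_eq_zero (hξ : MonotoneOn ξ (Set.Iic M)) {p i j : ℕ}
    (hj : j + p + 1 ≤ M) (hij : i + p < j) (x : ℝ) : bspline ξ p i x * bspline ξ p j x = 0 := by
  rcases lt_or_ge x (ξ j) with h | h
  · rw [bspline_eq_zero_of_notMem hξ hj (Or.inl h), mul_zero]
  · have : ξ (i + p + 1) ≤ ξ j :=
      hξ (Set.mem_Iic.2 (by omega)) (Set.mem_Iic.2 (by omega)) (by omega)
    rw [bspline_eq_zero_of_notMem hξ (by omega) (Or.inr (this.trans h)), zero_mul]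

theorem measurable_bspline (ξ : ℕ → ℝ) (p i : ℕ) : Measurable (bspline ξ p i) := by
  induction p generalizing i with
  | zero =>
    have : bspline ξ 0 i = fun x => if x ∈ Set.Ico (ξ i) (ξ (i + 1)) then (1 : ℝ) else 0 := by
      funext x; rw [bspline]; rfl
    rw [this]
    exact Measurable.ite measurableSet_Ico measurable_const measurable_const
  | succ p ih =>
    have : bspline ξ (p + 1) i = fun x => (x - ξ i) / (ξ (i + p + 1) - ξ i) * bspline ξ p i x +
        (ξ (i + p + 2) - x) / (ξ (i + p + 2) - ξ (i + 1)) * bspline ξ p (i + 1) x := by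
      funext x; rw [bspline]
    rw [this]
    have h1 := ih i
    have h2 := ih (i + 1)
    fun_prop

/-- B-splines are continuous away from the knots. -/
theorem continuousAt_bspline {p i : ℕ} (hi : i + p + 1 ≤ M) {x : ℝ} (hx : x ∉ ξ '' Set.Iic M) :
    ContinuousAt (bspline ξ p i) x := by
  induction p generalizing i with
  | zero =>
    have : bspline ξ 0 i = fun x => if x ∈ Set.Ico (ξ i) (ξ (i + 1)) then (1 : ℝ) else 0 := by
      funext x; rw [bspline]; rfl
    rw [this]
    have h1 : x ≠ ξ i := fun h => hx ⟨i, Set.mem_Iic.2 (by omega), h.symm⟩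
    have h2 : x ≠ ξ (i + 1) := fun h => hx ⟨i + 1, Set.mem_Iic.2 (by omega), h.symm⟩
    by_cases h : x ∈ Set.Ioo (ξ i) (ξ (i + 1))
    · refine (continuousAt_const (y := (1 : ℝ))).congr ?_
      filter_upwards [isOpen_Ioo.mem_nhds h] with y hy
      rw [if_pos (Set.Ioo_subset_Ico_self hy)]
    · have h' : x ∉ Set.Icc (ξ i) (ξ (i + 1)) := fun h3 =>
        h ⟨lt_of_le_of_ne h3.1 h1.symm, lt_of_le_of_ne h3.2 h2⟩
      refine (continuousAt_const (y := (0 : ℝ))).congr ?_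
      filter_upwards [isClosed_Icc.isOpen_compl.mem_nhds h'] with y hy
      rw [if_neg fun h4 => hy (Set.Ico_subset_Icc_self h4)]
  | succ p ih =>
    have : bspline ξ (p + 1) i = fun x => (x - ξ i) / (ξ (i + p + 1) - ξ i) * bspline ξ p i x +
        (ξ (i + p + 2) - x) / (ξ (i + p + 2) - ξ (i + 1)) * bspline ξ p (i + 1) x := by
      funext x; rw [bspline]
    rw [this]
    have h1 := ih (i := i) (by omega)
    have h2 := ih (i := i + 1) (by omega)
    fun_prop

/-- On the first knot span the first summand of the recursion stays positive in every degree. This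
span alone is enough to make the NURBS denominator positive off the knots. -/
theorem bspline_pos_of_mem_Ioo (hξ : MonotoneOn ξ (Set.Iic M)) {p i : ℕ} (hi : i + p + 1 ≤ M)
    {x : ℝ} (hx : x ∈ Set.Ioo (ξ i) (ξ (i + 1))) : 0 < bspline ξ p i x := by
  induction p with
  | zero => rw [bspline, if_pos ⟨hx.1.le, hx.2⟩]; norm_num
  | succ p ih =>
    have h1 : ξ (i + 1) ≤ ξ (i + p + 1) :=
      hξ (Set.mem_Iic.2 (by omega)) (Set.mem_Iic.2 (by omega)) (by omega)
    have h2 : ξ (i + p + 1) ≤ ξ (i + p + 2) :=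
      hξ (Set.mem_Iic.2 (by omega)) (Set.mem_Iic.2 (by omega)) (by omega)
    have h3 := hx.1
    have h4 := hx.2
    rw [bspline]
    exact add_pos_of_pos_of_nonneg
      (mul_pos (div_pos (by linarith) (by linarith)) (ih (by omega)))
      (mul_nonneg (div_nonneg (by linarith) (by linarith)) (bspline_nonneg hξ (by omega) x))

/-! ### Orders of vanishing at a knot and linear independence -/

/-- If at most `p + 1 - e` of the knots of a B-spline of degree `p` lie at `t`, and none before, then
the B-spline is `O((x - t) ^ e)` on the right of `t`. -/
theorem exists_bspline_le_mul_pow (hξ : MonotoneOn ξ (Set.Iic M)) {t : ℝ} {p i e : ℕ}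
    (hi : i + p + 1 ≤ M) (he : e ≤ p + 1) (hti : t ≤ ξ i) (ht : t < ξ (i + p + 1 - e)) :
    ∃ C, 0 ≤ C ∧ ∀ x, t ≤ x → bspline ξ p i x ≤ C * (x - t) ^ e := by
  -- If all knots lie strictly right of `t`, the spline vanishes up to `ξ i`, and beyond it `x - t`
  -- is bounded below; so any power works.
  have top : ∀ {p i : ℕ}, i + p + 1 ≤ M → t < ξ i → ∀ k : ℕ,
      ∃ C, 0 ≤ C ∧ ∀ x, t ≤ x → bspline ξ p i x ≤ C * (x - t) ^ k := by
    intro p i hi ht k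
    have h0 : 0 < ξ i - t := sub_pos.2 ht
    refine ⟨2 ^ p / (ξ i - t) ^ k, by positivity, fun x hx => ?_⟩
    rcases lt_or_ge x (ξ i) with h | h
    · rw [bspline_eq_zero_of_notMem hξ hi (Or.inl h)]
      have := sub_nonneg.2 hx
      positivity
    · refine (bspline_le_two_pow hξ hi x).trans ?_
      rw [div_mul_eq_mul_div, le_div_iff₀ (by positivity)]
      gcongr
  induction p generalizing i e with
  | zero =>
    obtain rfl | rfl : e = 0 ∨ e = 1 := by omega
    · refine ⟨1, zero_le_one, fun x _ => ?_⟩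
      rw [pow_zero, one_mul]
      exact (bspline_le_two_pow hξ hi x).trans_eq (pow_zero 2)
    · exact top hi ht 1
  | succ p ih =>
    obtain rfl | ⟨e, rfl⟩ : e = 0 ∨ ∃ k, e = k + 1 := by
      cases e with
      | zero => exact Or.inl rfl
      | succ k => exact Or.inr ⟨k, rfl⟩
    · exact ⟨2 ^ (p + 1), by positivity, fun x _ => by
        simpa using bspline_le_two_pow hξ hi x⟩
    have e1 : i + (p + 1) + 1 - (e + 1) = i + p + 1 - e := by omega
    obtain rfl | he' : e = p + 1 ∨ e ≤ p := by omega
    · exact top hi (by rwa [show i + (p + 1) + 1 - (p + 1 + 1) = i by omega] at ht) _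
    have e2 : i + 1 + p + 1 - (e + 1) = i + p + 1 - e := by omega
    rw [e1] at ht
    have hmono : ξ i ≤ ξ (i + 1) :=
      hξ (Set.mem_Iic.2 (by omega)) (Set.mem_Iic.2 (by omega)) (by omega)
    -- The numerator `x - ξ i ≤ x - t` supplies one power, so exponent `e` suffices in the first
    -- summand. The second spline no longer has the knot `ξ i`, so it already has exponent `e + 1`.
    obtain ⟨C₁, hC₁, h₁⟩ := ih (i := i) (e := e) (by omega) (by omega) hti ht
    obtain ⟨C₂, hC₂, h₂⟩ := ih (i := i + 1) (e := e + 1) (by omega) (by omega)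
      (hti.trans hmono) (by rwa [e2])
    have hden : 0 ≤ ξ (i + p + 1) - ξ i := sub_nonneg.2
      (hξ (Set.mem_Iic.2 (by omega)) (Set.mem_Iic.2 (by omega)) (by omega))
    refine ⟨C₁ / (ξ (i + p + 1) - ξ i) + C₂, by positivity, fun x hx => ?_⟩
    have hxt : 0 ≤ x - t := sub_nonneg.2 hx
    rw [bspline, add_mul]
    refine add_le_add ?_ ?_
    · calc (x - ξ i) / (ξ (i + p + 1) - ξ i) * bspline ξ p i x
          ≤ (x - t) / (ξ (i + p + 1) - ξ i) * (C₁ * (x - t) ^ e) := by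
            have := bspline_nonneg hξ (p := p) (i := i) (by omega) x
            have := h₁ x hx
            gcongr
        _ = C₁ / (ξ (i + p + 1) - ξ i) * (x - t) ^ (e + 1) := by ring
    · refine le_trans ?_ (h₂ x hx)
      rcases eq_or_ne (bspline ξ p (i + 1) x) 0 with h | h
      · rw [h, mul_zero]
      · have h3 := mt (bspline_eq_zero_of_notMem hξ (by omega)) h
        push Not at h3
        have e3 : i + 1 + p + 1 = i + p + 2 := by omega
        rw [e3] at h3
        exact mul_le_of_le_one_left (bspline_nonneg hξ (by omega) x)
          (div_le_one_of_le₀ (by linarith) (by linarith))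

/-- If exactly the first `p + 1 - e` knots of a B-spline of degree `p` lie at `t`, then the B-spline
is at least a positive multiple of `(x - t) ^ e` on the right of `t`. -/
theorem exists_mul_pow_le_bspline (hξ : MonotoneOn ξ (Set.Iic M)) {t : ℝ} {p i e : ℕ}
    (hi : i + p + 1 ≤ M) (he : e ≤ p) (hti : ∀ j, i ≤ j → j ≤ i + p - e → ξ j = t)
    (ht : t < ξ (i + p + 1 - e)) :
    ∃ c, 0 < c ∧ ∀ x, t < x → x ≤ (t + ξ (i + p + 1 - e)) / 2 →
      c * (x - t) ^ e ≤ bspline ξ p i x := by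
  induction p generalizing i e with
  | zero =>
    obtain rfl : e = 0 := by omega
    refine ⟨1, one_pos, fun x hx hx' => ?_⟩
    have h0 := hti i le_rfl (by omega)
    simp only [add_zero, Nat.sub_zero] at ht hx'
    rw [bspline, if_pos ⟨by linarith, by linarith⟩]
    simp
  | succ p ih =>
    have h0 : ξ i = t := hti i le_rfl (by omega)
    have hle : ∀ j k, j ≤ k → k ≤ M → ξ j ≤ ξ k := fun j k hjk hk =>
      hξ (Set.mem_Iic.2 (by omega)) (Set.mem_Iic.2 hk) hjk
    cases e with
    | zero =>
      have e1 : i + 1 + p + 1 - 0 = i + (p + 1) + 1 - 0 := by omega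
      obtain ⟨c, hc, h⟩ := ih (i := i + 1) (e := 0) (by omega) (by omega)
        (fun j h1 h2 => hti j (by omega) (by omega)) (by rwa [e1])
      rw [e1] at h
      refine ⟨c / 2, by positivity, fun x hx hx' => ?_⟩
      have h1 := h x hx hx'
      have h2 : ξ (i + p + 1) = t := hti _ (by omega) (by omega)
      have h3 : ξ (i + 1) = t := hti _ (by omega) (by omega)
      have e2 : i + (p + 1) + 1 - 0 = i + p + 2 := by omega
      rw [e2] at ht hx'
      -- With `e = 0` all knots but the last coincide, so the first quotient has zero denominator
      -- and is read as `0`. In the second, `x` lies left of the midpoint, so the ratio is at least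
      -- `1 / 2`.
      rw [bspline, h0, h2, h3, sub_self, div_zero, zero_mul, zero_add]
      have h4 : 1 / 2 ≤ (ξ (i + p + 2) - x) / (ξ (i + p + 2) - t) := by
        rw [div_le_div_iff₀ two_pos (by linarith)]
        linarith
      calc c / 2 * (x - t) ^ 0 = 1 / 2 * (c * (x - t) ^ 0) := by ring
        _ ≤ _ := mul_le_mul h4 h1 (by positivity) (le_trans (by norm_num) h4)
    | succ e =>
      -- Here the first summand alone gives the bound, its ratio contributing the extra factor `x -
      -- t`; the second is dropped as nonnegative.
      have e1 : i + (p + 1) + 1 - (e + 1) = i + p + 1 - e := by omega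
      rw [e1] at ht ⊢
      obtain ⟨c, hc, h⟩ := ih (i := i) (e := e) (by omega) (by omega)
        (fun j h1 h2 => hti j h1 (by omega)) ht
      have h1 : t < ξ (i + p + 1) := ht.trans_le (hle _ _ (by omega) (by omega))
      refine ⟨c / (ξ (i + p + 1) - t), div_pos hc (sub_pos.2 h1), fun x hx hx' => ?_⟩
      have h2 : ξ (i + p + 1 - e) ≤ ξ (i + p + 2) := hle _ _ (by omega) (by omega)
      have h3 : ξ (i + 1) ≤ ξ (i + p + 2) := hle _ _ (by omega) (by omega)
      have h4 : 0 ≤ (ξ (i + p + 2) - x) / (ξ (i + p + 2) - ξ (i + 1)) :=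
        div_nonneg (by linarith) (by linarith)
      have h5 := bspline_nonneg hξ (p := p) (i := i + 1) (by omega) x
      rw [bspline, h0]
      refine le_trans ?_ (le_add_of_nonneg_right (mul_nonneg h4 h5))
      have h6 := h x hx hx'
      calc c / (ξ (i + p + 1) - t) * (x - t) ^ (e + 1)
          = (x - t) / (ξ (i + p + 1) - t) * (c * (x - t) ^ e) := by ring
        _ ≤ _ := mul_le_mul_of_nonneg_left h6 (div_nonneg (by linarith) (by linarith))

/-- Linear independence of consecutive B-splines on the open unit interval without its knots. -/
theorem bspline_linearIndependent {p N : ℕ} (h : IsOpenKnotVector p N ξ) {a n : ℕ}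
    (hn : a + n ≤ N) (v : Fin n → ℝ)
    (hv : ∀ x ∈ Set.Ioo (0 : ℝ) 1 \ ξ '' Set.Iic (N + p), ∑ i, v i * bspline ξ p (a + i) x = 0) :
    v = 0 := by
  have hξ := h.monotoneOn
  have hle : ∀ j k, j ≤ k → k ≤ N + p → ξ j ≤ ξ k := fun j k hjk hk => h.mono j k hjk hk
  by_contra hne
  obtain ⟨i₀, hi₀⟩ : ∃ i, v i ≠ 0 := by
    by_contra! H
    exact hne (funext H)
  obtain ⟨i, hi, hmin⟩ := WellFounded.has_min (wellFounded_lt (α := Fin n)) {i | v i ≠ 0} ⟨i₀, hi₀⟩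
  have hlt : ∀ j < i, v j = 0 := fun j hj => by
    by_contra H
    exact hmin j H hj
  have hiN : a + i < N := lt_of_lt_of_le (Nat.add_lt_add_left i.isLt a) hn
  have hex : ∃ k, ξ (a + i) < ξ (a + i + k) := ⟨p + 1, h.mult _ hiN⟩
  classical
  -- `m` is the number of knots equal to `ξ (a + i)` from index `a + i` on. The multiplicity
  -- condition gives `m ≤ p + 1`, so the leading exponent `e = p + 1 - m` is a natural number.
  obtain ⟨m, hm, hm'⟩ : ∃ m, ξ (a + i) < ξ (a + i + m) ∧ ∀ k < m, ¬ ξ (a + i) < ξ (a + i + k) :=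
    ⟨Nat.find hex, Nat.find_spec hex, fun k hk => Nat.find_min hex hk⟩
  have hmp : m ≤ p + 1 := by
    by_contra H
    exact hm' (p + 1) (by omega) (h.mult _ hiN)
  have hm0 : 1 ≤ m := by
    rcases Nat.eq_zero_or_pos m with rfl | H
    · exact absurd hm (lt_irrefl _)
    · exact H
  set t := ξ (a + i) with ht
  have hconst : ∀ j, a + i ≤ j → j < a + i + m → ξ j = t := fun j h1 h2 => by
    have := hm' (j - (a + i)) (by omega)
    rw [show a + i + (j - (a + i)) = j by omega] at this
    exact le_antisymm (not_lt.1 this) (hle _ _ h1 (by omega))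
  obtain ⟨e, he⟩ : ∃ e, e + m = p + 1 := ⟨p + 1 - m, by omega⟩
  have e1 : a + i + p + 1 - e = a + i + m := by omega
  obtain ⟨c, hc, hlow⟩ := exists_mul_pow_le_bspline hξ (t := t) (p := p) (i := a + i) (e := e)
    (by omega) (by omega) (fun j h1 h2 => hconst j h1 (by omega)) (by rwa [e1])
  rw [e1] at hlow
  have hup : ∀ j : Fin n, ∃ C, 0 ≤ C ∧
      (i < j → ∀ x, t ≤ x → bspline ξ p (a + j) x ≤ C * (x - t) ^ (e + 1)) := fun j => by
    by_cases hj : i < j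
    · have hj' : (i : ℕ) < j := hj
      have hjn := j.isLt
      obtain ⟨C, hC, H⟩ := exists_bspline_le_mul_pow hξ (t := t) (p := p) (i := a + j) (e := e + 1)
        (by omega) (by omega) (hle _ _ (by omega) (by omega))
        (hm.trans_le (hle _ _ (by omega) (by omega)))
      exact ⟨C, hC, fun _ => H⟩
    · exact ⟨0, le_rfl, fun H => absurd H hj⟩
  choose C hC hup using hup
  set K := ∑ j, |v j| * C j with hK
  have hK0 : 0 ≤ K := Finset.sum_nonneg fun j _ => mul_nonneg (abs_nonneg _) (hC j)
  have hvi : 0 < |v i| := abs_pos.2 hi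
  set q := ξ (a + i + m) with hq
  have hq1 : q ≤ 1 := by
    rw [← h.right (N + p) (by omega) le_rfl]
    exact hle _ _ (by omega) le_rfl
  have ht0 : 0 ≤ t := by
    rw [← h.left 0 (by omega)]
    exact hle _ _ (by omega) (by omega)
  -- The first bound puts `t + δ` in the range of the lower estimate and strictly between the
  -- successive knot values `t` and `q`, hence off the knots. The second makes the tail `K δ^(e+1)`
  -- smaller than the leading term `|v i| c δ^e`; `K + 1` avoids division by zero.
  obtain ⟨δ, hδ0, hδ1, hδ2⟩ : ∃ δ, 0 < δ ∧ δ ≤ (q - t) / 2 ∧ K * δ < |v i| * c := by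
    refine ⟨min ((q - t) / 2) (|v i| * c / (K + 1) ), ?_, min_le_left _ _, ?_⟩
    · exact lt_min (by linarith) (by positivity)
    · have h1 : 0 < |v i| * c / (K + 1) := by positivity
      calc K * min ((q - t) / 2) (|v i| * c / (K + 1)) ≤ K * (|v i| * c / (K + 1)) :=
            mul_le_mul_of_nonneg_left (min_le_right _ _) hK0
        _ < (K + 1) * (|v i| * c / (K + 1)) := by nlinarith
        _ = |v i| * c := by field_simp
  have hx : t + δ ∈ Set.Ioo (0 : ℝ) 1 \ ξ '' Set.Iic (N + p) := by
    refine ⟨⟨by linarith, by linarith⟩, ?_⟩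
    rintro ⟨j, hj, hjx⟩
    have hj' : j ≤ N + p := hj
    rcases lt_or_ge j (a + i + m) with h1 | h1
    · rcases lt_or_ge j (a + i) with h2 | h2
      · have := hle j (a + i) h2.le (by omega)
        linarith
      · have := hconst j h2 h1
        linarith
    · have := hle _ _ h1 hj'
      linarith
  have hsum := hv _ hx
  rw [← Finset.add_sum_erase _ _ (Finset.mem_univ i)] at hsum
  have hrest : |∑ j ∈ Finset.univ.erase i, v j * bspline ξ p (a + j) (t + δ)| ≤
      K * δ ^ (e + 1) := by
    rw [hK, Finset.sum_mul]
    refine (Finset.abs_sum_le_sum_abs _ _).trans ((Finset.sum_le_sum fun j hj => ?_).trans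
      (Finset.sum_le_sum_of_subset_of_nonneg (Finset.erase_subset i Finset.univ)
        fun j _ _ => mul_nonneg (mul_nonneg (abs_nonneg _) (hC j)) (by positivity)))
    have hjn := j.isLt
    rcases lt_or_ge j i with h1 | h1
    · rw [hlt j h1]
      simp
    · have h2 := hup j (lt_of_le_of_ne h1 (Finset.ne_of_mem_erase hj).symm) (t + δ) (by linarith)
      rw [add_sub_cancel_left] at h2
      rw [abs_mul, abs_of_nonneg (bspline_nonneg hξ (by omega) _), mul_assoc]
      exact mul_le_mul_of_nonneg_left h2 (abs_nonneg _)
  have hmain := hlow (t + δ) (by linarith) (by linarith)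
  rw [add_sub_cancel_left] at hmain
  have h1 : |v i| * (c * δ ^ e) ≤ |v i * bspline ξ p (a + i) (t + δ)| := by
    rw [abs_mul]
    exact mul_le_mul_of_nonneg_left (hmain.trans (le_abs_self _)) (abs_nonneg _)
  rw [eq_neg_of_add_eq_zero_left hsum, abs_neg] at h1
  have h2 : K * δ * δ ^ e < |v i| * c * δ ^ e := mul_lt_mul_of_pos_right hδ2 (by positivity)
  have h3 : K * δ ^ (e + 1) = K * δ * δ ^ e := by ring
  have h4 := h1.trans hrest
  rw [h3] at h4
  linarith

/-- Off the knots, some B-spline of an open knot vector is positive. -/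
theorem exists_bspline_pos {p N : ℕ} (h : IsOpenKnotVector p N ξ) {x : ℝ}
    (hx : x ∈ Set.Ioo (0 : ℝ) 1 \ ξ '' Set.Iic (N + p)) : ∃ i : Fin N, 0 < bspline ξ p i x := by
  classical
  have hex : ∃ k, x < ξ k := ⟨N + p, by rw [h.right _ (by omega) le_rfl]; exact hx.1.2⟩
  obtain ⟨k, hk, hk'⟩ : ∃ k, x < ξ k ∧ ∀ j < k, ¬ x < ξ j :=
    ⟨Nat.find hex, Nat.find_spec hex, fun k hk => Nat.find_min hex hk⟩
  -- The leading zeros and trailing ones force `p < k ≤ N`, so `k - 1` is a valid index and `x` lies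
  -- in the first knot span of that spline.
  have hkp : p < k := by
    by_contra H
    rw [h.left k (by omega)] at hk
    exact absurd hk (not_lt.2 hx.1.1.le)
  have hkN : k ≤ N := by
    by_contra H
    refine hk' N (by omega) ?_
    rw [h.right N le_rfl (by omega)]
    exact hx.1.2
  obtain ⟨k, rfl⟩ : ∃ m, k = m + 1 := ⟨k - 1, by omega⟩
  refine ⟨⟨k, by omega⟩, bspline_pos_of_mem_Ioo h.monotoneOn (p := p) (by omega) ⟨?_, hk⟩⟩
  exact lt_of_le_of_ne (not_lt.1 (hk' k (by omega)))
    fun h1 => hx.2 ⟨k, Set.mem_Iic.2 (by omega), h1⟩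
end

/-! ### Independence of tensor products -/

noncomputable section

theorem sum_multiIndex_succ {d : ℕ} {n : Fin (d + 1) → ℕ} {A : Type*} [AddCommMonoid A]
    (g : MultiIndex n → A) :
    ∑ i, g i = ∑ r : MultiIndex fun l : Fin d => n l.succ, ∑ i : Fin (n 0),
      g (Fin.cons (α := fun l => Fin (n l)) i r) := by
  rw [Finset.sum_comm, ← Fintype.sum_prod_type',
    ← (Fin.consEquiv fun l : Fin (d + 1) => Fin (n l)).sum_comp]
  rfl

/-- Products of linearly independent univariate functions are linearly independent. -/
theorem tensorProduct_linearIndependent {d : ℕ} {n : Fin d → ℕ}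
    (β : (l : Fin d) → Fin (n l) → ℝ → ℝ) (U : Fin d → Set ℝ)
    (hβ : ∀ l (v : Fin (n l) → ℝ), (∀ x ∈ U l, ∑ i, v i * β l i x = 0) → v = 0)
    (v : MultiIndex n → ℝ)
    (hv : ∀ x ∈ Set.univ.pi U, ∑ i, v i * ∏ l, β l (i l) (x l) = 0) : v = 0 := by
  induction d with
  | zero =>
    funext i
    have := hv (fun l => l.elim0) (fun l => l.elim0)
    rw [Fintype.sum_unique] at this
    simpa [Subsingleton.elim i default] using this
  | succ d ih =>
    have key : ∀ r : MultiIndex fun l : Fin d => n l.succ,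
        (fun i : Fin (n 0) => v (Fin.cons (α := fun l => Fin (n l)) i r)) = 0 := by
      intro r
      -- With `x₀` frozen, the induction hypothesis kills the coefficients `∑ i, v (i, r) β_i(x₀)`;
      -- letting `x₀` vary leaves a univariate relation for each `r`.
      refine hβ 0 _ fun x₀ hx₀ => ?_
      refine congrFun (ih (fun l => β l.succ) (fun l => U l.succ) (fun l => hβ l.succ)
        (fun r => ∑ i : Fin (n 0), v (Fin.cons (α := fun l => Fin (n l)) i r) * β 0 i x₀)
        fun x hx => ?_) r
      have := hv (Fin.cons x₀ x) fun l _ => by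
        refine Fin.cases ?_ (fun l => ?_) l
        · exact hx₀
        · exact hx l (Set.mem_univ _)
      rw [sum_multiIndex_succ] at this
      rw [← this]
      refine Finset.sum_congr rfl fun r _ => ?_
      rw [Finset.sum_mul]
      refine Finset.sum_congr rfl fun i _ => ?_
      rw [Fin.prod_univ_succ, mul_assoc]
      rfl
    funext i
    have := congrFun (key fun l => i l.succ) (i 0)
    rwa [show Fin.cons (α := fun l => Fin (n l)) (i 0) (fun l => i l.succ) = i from
      Fin.cons_self_tail i] at this

/-! ### Weighted Gram matrices and definiteness -/

/-- The Gram matrix of the functions `φ i` with respect to the density `c`. -/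
def weightedGram {X ι : Type*} [MeasurableSpace X] (μ : Measure X) (c : X → ℝ) (φ : ι → X → ℝ) :
    Matrix ι ι ℝ :=
  Matrix.of fun i j => ∫ x, c x * φ i x * φ j x ∂μ

section Gram
variable {X : Type*} [MeasurableSpace X] {μ : Measure X} {c : X → ℝ}

theorem isHermitian_weightedGram {ι : Type*} (φ : ι → X → ℝ) :
    (weightedGram μ c φ).IsHermitian := by
  refine Matrix.IsHermitian.ext fun i j => ?_
  simp only [weightedGram, Matrix.of_apply, star_trivial]
  exact integral_congr_ae (ae_of_all _ fun x => by ring)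

variable {ι : Type*} [Fintype ι] {φ : ι → X → ℝ}

theorem dotProduct_weightedGram_mulVec
    (hφ : ∀ i j, Integrable (fun x => c x * φ i x * φ j x) μ) (v : ι → ℝ) :
    star v ⬝ᵥ (weightedGram μ c φ).mulVec v = ∫ x, c x * (∑ i, v i * φ i x) ^ 2 ∂μ := by
  have h : ∀ x, c x * (∑ i, v i * φ i x) ^ 2 =
      ∑ i, ∑ j, v i * v j * (c x * φ i x * φ j x) := by
    intro x
    rw [sq, Finset.sum_mul_sum, Finset.mul_sum]
    refine Finset.sum_congr rfl fun i _ => ?_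
    rw [Finset.mul_sum]
    exact Finset.sum_congr rfl fun j _ => by ring
  simp_rw [h]
  rw [integral_finsetSum _ fun i _ => integrable_finsetSum _ fun j _ => (hφ i j).const_mul _]
  refine Finset.sum_congr rfl fun i _ => ?_
  rw [integral_finsetSum _ fun j _ => (hφ i j).const_mul _, Matrix.mulVec, dotProduct,
    Finset.mul_sum]
  refine Finset.sum_congr rfl fun j _ => ?_
  rw [integral_const_mul, weightedGram, Matrix.of_apply, star_trivial]
  ring

theorem posSemidef_weightedGram (hc : ∀ᵐ x ∂μ, 0 ≤ c x)
    (hφ : ∀ i j, Integrable (fun x => c x * φ i x * φ j x) μ) :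
    (weightedGram μ c φ).PosSemidef := by
  refine Matrix.PosSemidef.of_dotProduct_mulVec_nonneg (isHermitian_weightedGram φ) fun v => ?_
  rw [dotProduct_weightedGram_mulVec hφ]
  refine integral_nonneg_of_ae ?_
  filter_upwards [hc] with x hx
  exact mul_nonneg hx (sq_nonneg _)

theorem posDef_weightedGram (hc : ∀ᵐ x ∂μ, 0 < c x)
    (hφ : ∀ i j, Integrable (fun x => c x * φ i x * φ j x) μ)
    (hind : ∀ v : ι → ℝ, (∀ᵐ x ∂μ, ∑ i, v i * φ i x = 0) → v = 0) :
    (weightedGram μ c φ).PosDef := by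
  refine Matrix.PosDef.of_dotProduct_mulVec_pos (isHermitian_weightedGram φ) fun v hv => ?_
  rw [dotProduct_weightedGram_mulVec hφ]
  have h0 : 0 ≤ᵐ[μ] fun x => c x * (∑ i, v i * φ i x) ^ 2 := by
    filter_upwards [hc] with x hx
    exact mul_nonneg hx.le (sq_nonneg _)
  have hint : Integrable (fun x => c x * (∑ i, v i * φ i x) ^ 2) μ := by
    have h : (fun x => c x * (∑ i, v i * φ i x) ^ 2) =
        fun x => ∑ i, ∑ j, v i * v j * (c x * φ i x * φ j x) := by
      funext x
      rw [sq, Finset.sum_mul_sum, Finset.mul_sum]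
      refine Finset.sum_congr rfl fun i _ => ?_
      rw [Finset.mul_sum]
      exact Finset.sum_congr rfl fun j _ => by ring
    rw [h]
    exact integrable_finsetSum _ fun i _ => integrable_finsetSum _ fun j _ => (hφ i j).const_mul _
  refine lt_of_le_of_ne (integral_nonneg_of_ae h0) fun h => hv (hind v ?_)
  filter_upwards [(integral_eq_zero_iff_of_nonneg_ae h0 hint).1 h.symm, hc] with x hx hcx
  simpa [hcx.ne'] using hx

end Gram

/-! ### Block structure of Gram matrices of products -/

section Hierarchical
variable {X : Type*} [MeasurableSpace X] {μ : Measure X}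

/-- The factors live on one common space `X` rather than on separate coordinates. Absorbing two of
them into the density therefore leaves the measure unchanged, and Fubini is not needed. -/
theorem matrixBlock_weightedGram_prod {d : ℕ} {n : Fin (d + 1) → ℕ} (c : X → ℝ)
    (f : (l : Fin (d + 1)) → Fin (n l) → X → ℝ) (i j : Fin (n 0)) :
    matrixBlock (weightedGram μ c fun (i : MultiIndex n) x => ∏ l, f l (i l) x) i j =
      weightedGram μ (fun x => c x * f 0 i x * f 0 j x)
        fun (r : MultiIndex fun l : Fin d => n l.succ) x => ∏ l, f l.succ (r l) x := by
  ext r s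
  simp only [matrixBlock, weightedGram, Matrix.of_apply]
  refine integral_congr_ae (ae_of_all _ fun x => ?_)
  simp only [Fin.prod_univ_succ, Fin.cons_zero, Fin.cons_succ]
  ring

theorem integrable_block {d : ℕ} {n : Fin (d + 1) → ℕ} {c : X → ℝ}
    {f : (l : Fin (d + 1)) → Fin (n l) → X → ℝ}
    (hint : ∀ i j : MultiIndex n,
      Integrable (fun x => c x * (∏ l, f l (i l) x) * ∏ l, f l (j l) x) μ)
    (i j : Fin (n 0)) (r s : MultiIndex fun l : Fin d => n l.succ) :
    Integrable (fun x => c x * f 0 i x * f 0 j x * (∏ l, f l.succ (r l) x) *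
      ∏ l, f l.succ (s l) x) μ := by
  refine (hint (Fin.cons (α := fun l => Fin (n l)) i r)
    (Fin.cons (α := fun l => Fin (n l)) j s)).congr (ae_of_all _ fun x => ?_)
  simp only [Fin.prod_univ_succ, Fin.cons_zero, Fin.cons_succ]
  ring

/-- The density changes at every level, so the induction runs over all nonnegative densities. Strict
positivity would be lost where a factor vanishes, which is why blocks are only claimed semidefinite.
-/
theorem isHierSPSD_weightedGram_prod {d : ℕ} {n : Fin d → ℕ} {c : X → ℝ}
    {f : (l : Fin d) → Fin (n l) → X → ℝ} (hc : ∀ᵐ x ∂μ, 0 ≤ c x) (hf : ∀ l i x, 0 ≤ f l i x)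
    (hint : ∀ i j : MultiIndex n,
      Integrable (fun x => c x * (∏ l, f l (i l) x) * ∏ l, f l (j l) x) μ) :
    IsHierSPSD n (weightedGram μ c fun (i : MultiIndex n) x => ∏ l, f l (i l) x) := by
  induction d generalizing c with
  | zero => exact posSemidef_weightedGram hc hint
  | succ d ih =>
    cases d with
    | zero => exact posSemidef_weightedGram hc hint
    | succ d =>
      refine ⟨posSemidef_weightedGram hc hint, fun i j => ?_⟩
      rw [matrixBlock_weightedGram_prod]
      refine ih (f := fun l => f l.succ) ?_ (fun l => hf l.succ) (integrable_block hint i j)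
      filter_upwards [hc] with x hx
      exact mul_nonneg (mul_nonneg hx (hf 0 i x)) (hf 0 j x)

theorem isHierSPD_weightedGram_prod {d : ℕ} {n : Fin d → ℕ} {c : X → ℝ}
    {f : (l : Fin d) → Fin (n l) → X → ℝ} (hc : ∀ᵐ x ∂μ, 0 ≤ c x) (hf : ∀ l i x, 0 ≤ f l i x)
    (hint : ∀ i j : MultiIndex n,
      Integrable (fun x => c x * (∏ l, f l (i l) x) * ∏ l, f l (j l) x) μ)
    (hpos : (weightedGram μ c fun (i : MultiIndex n) x => ∏ l, f l (i l) x).PosDef) :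
    IsHierSPD n (weightedGram μ c fun (i : MultiIndex n) x => ∏ l, f l (i l) x) := by
  match d with
  | 0 => exact hpos
  | 1 => exact hpos
  | d + 2 =>
    refine ⟨hpos, fun i j => ?_⟩
    rw [matrixBlock_weightedGram_prod]
    refine isHierSPSD_weightedGram_prod (f := fun l => f l.succ) ?_ (fun l => hf l.succ)
      (integrable_block hint i j)
    filter_upwards [hc] with x hx
    exact mul_nonneg (mul_nonneg hx (hf 0 i x)) (hf 0 j x)

end Hierarchical

theorem isLevelBanded_of_apply_eq_zero {d : ℕ} {n b : Fin d → ℕ}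
    {B : Matrix (MultiIndex n) (MultiIndex n) ℝ}
    (h : ∀ (i j : MultiIndex n) (l : Fin d),
      ((b l : ℕ) : ℤ) < |((i l : ℕ) : ℤ) - ((j l : ℕ) : ℤ)| → B i j = 0) :
    IsLevelBanded n b B := by
  induction d with
  | zero => trivial
  | succ d ih =>
    refine fun i j => ⟨fun hij => ?_, ih fun r s l hl => ?_⟩
    · ext r s
      exact h _ _ 0 hij
    · exact h _ _ l.succ hl

end

/-! ### Tensor-product B-splines and NURBS on the parametric domain -/

section
variable {d : ℕ} {p N : Fin d → ℕ} {ξ : Fin d → ℕ → ℝ}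

theorem bspline_fin_nonneg (hξ : ∀ l, IsOpenKnotVector (p l) (N l) (ξ l)) (l : Fin d)
    (i : Fin (N l)) (x : ℝ) : 0 ≤ bspline (ξ l) (p l) i x :=
  bspline_nonneg (hξ l).monotoneOn (by have := i.isLt; omega) x

theorem tensorBSpline_nonneg (hξ : ∀ l, IsOpenKnotVector (p l) (N l) (ξ l)) (i : MultiIndex N)
    (x : Fin d → ℝ) : 0 ≤ tensorBSpline p ξ i x :=
  Finset.prod_nonneg fun l _ => bspline_fin_nonneg hξ l (i l) (x l)

theorem tensorBSpline_le (hξ : ∀ l, IsOpenKnotVector (p l) (N l) (ξ l)) (i : MultiIndex N)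
    (x : Fin d → ℝ) : tensorBSpline p ξ i x ≤ ∏ l, 2 ^ p l :=
  Finset.prod_le_prod (fun l _ => bspline_fin_nonneg hξ l (i l) (x l)) fun l _ =>
    bspline_le_two_pow (hξ l).monotoneOn (by have := (i l).isLt; omega) (x l)

theorem measurable_tensorBSpline (p : Fin d → ℕ) (ξ : Fin d → ℕ → ℝ) (i : MultiIndex N) :
    Measurable (tensorBSpline p ξ i) :=
  Finset.measurable_fun_prod _ fun l _ =>
    (measurable_bspline (ξ l) (p l) (i l)).comp (measurable_pi_apply l)

theorem tensorBSpline_mul_eq_zero (hξ : ∀ l, IsOpenKnotVector (p l) (N l) (ξ l))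
    {i j : MultiIndex N} {l : Fin d}
    (h : ((p l : ℕ) : ℤ) < |((i l : ℕ) : ℤ) - ((j l : ℕ) : ℤ)|) (x : Fin d → ℝ) :
    tensorBSpline p ξ i x * tensorBSpline p ξ j x = 0 := by
  have hi := (i l).isLt
  have hj := (j l).isLt
  have hl : bspline (ξ l) (p l) (i l) (x l) * bspline (ξ l) (p l) (j l) (x l) = 0 := by
    rcases lt_abs.1 h with h | h
    · rw [mul_comm]
      exact bspline_mul_bspline_eq_zero (hξ l).monotoneOn (by omega) (by omega) _
    · exact bspline_mul_bspline_eq_zero (hξ l).monotoneOn (by omega) (by omega) _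
  rw [tensorBSpline, tensorBSpline, ← Finset.prod_mul_distrib]
  exact Finset.prod_eq_zero (Finset.mem_univ l) hl

/-- The points of the parametric domain none of whose coordinates is a knot. -/
def offKnots (p N : Fin d → ℕ) (ξ : Fin d → ℕ → ℝ) : Set (Fin d → ℝ) :=
  Set.univ.pi fun l => Set.Ioo (0 : ℝ) 1 \ ξ l '' Set.Iic (N l + p l)

theorem isOpen_offKnots (p N : Fin d → ℕ) (ξ : Fin d → ℕ → ℝ) : IsOpen (offKnots p N ξ) :=
  isOpen_set_pi Set.finite_univ fun _ _ =>
    isOpen_Ioo.sdiff ((Set.finite_Iic _).image _).isClosed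

theorem offKnots_subset_paramDomain : offKnots p N ξ ⊆ paramDomain d :=
  Set.pi_mono fun _ _ => Set.sdiff_subset

theorem continuousOn_tensorBSpline (i : MultiIndex N) :
    ContinuousOn (tensorBSpline p ξ i) (offKnots p N ξ) := by
  refine continuousOn_finsetProd _ fun l _ x hx => ContinuousAt.continuousWithinAt ?_
  have hi := (i l).isLt
  exact ContinuousAt.comp (f := fun x : Fin d → ℝ => x l)
    (continuousAt_bspline (M := N l + p l) (by omega) (hx l (Set.mem_univ l)).2)
    (continuous_apply l).continuousAt

/-- Off the knots the splines are continuous on an open set, so vanishing almost everywhere there is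
vanishing everywhere there. Splines may jump at knots of full multiplicity, hence the restriction.
-/
theorem tensorBSpline_linearIndependent (hξ : ∀ l, IsOpenKnotVector (p l) (N l) (ξ l))
    {a n : Fin d → ℕ} (hn : ∀ l, a l + n l ≤ N l) (v : MultiIndex n → ℝ)
    (hv : ∀ᵐ x ∂(volume.restrict (offKnots p N ξ)),
      ∑ i, v i * tensorBSpline p ξ (keptIndex hn i) x = 0) : v = 0 := by
  have h := Measure.eqOn_open_of_ae_eq hv (isOpen_offKnots p N ξ)
    (continuousOn_finsetSum _ fun i _ =>
      continuousOn_const.mul (continuousOn_tensorBSpline (keptIndex hn i))) continuousOn_const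
  exact tensorProduct_linearIndependent (fun l i => bspline (ξ l) (p l) (a l + i)) _
    (fun l v hv => bspline_linearIndependent (hξ l) (hn l) v hv) v h

theorem sum_weight_mul_tensorBSpline_pos (hξ : ∀ l, IsOpenKnotVector (p l) (N l) (ξ l))
    {w : MultiIndex N → ℝ} (hw : ∀ i, 0 < w i) {x : Fin d → ℝ} (hx : x ∈ offKnots p N ξ) :
    0 < ∑ j, w j * tensorBSpline p ξ j x := by
  choose i hi using fun l => exists_bspline_pos (hξ l) (hx l (Set.mem_univ l))
  exact Finset.sum_pos' (fun j _ => mul_nonneg (hw j).le (tensorBSpline_nonneg hξ j x))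
    ⟨i, Finset.mem_univ _, mul_pos (hw i) (Finset.prod_pos fun l _ => hi l)⟩

/-- The numerator is one term of the nonnegative sum in the denominator. Where that sum vanishes the
quotient is read as `0`, so the bound holds at every point. -/
theorem abs_nurbs_le_one (hξ : ∀ l, IsOpenKnotVector (p l) (N l) (ξ l))
    {w : MultiIndex N → ℝ} (hw : ∀ i, 0 < w i) (i : MultiIndex N) (x : Fin d → ℝ) :
    |nurbs p ξ w i x| ≤ 1 := by
  have h : ∀ j, 0 ≤ w j * tensorBSpline p ξ j x := fun j =>
    mul_nonneg (hw j).le (tensorBSpline_nonneg hξ j x)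
  have hs : 0 ≤ ∑ j, w j * tensorBSpline p ξ j x := Finset.sum_nonneg fun j _ => h j
  rw [nurbs, abs_of_nonneg (div_nonneg (h i) hs)]
  exact div_le_one_of_le₀ (Finset.single_le_sum (fun j _ => h j) (Finset.mem_univ i)) hs

theorem measurable_nurbs (p : Fin d → ℕ) (ξ : Fin d → ℕ → ℝ) (w : MultiIndex N → ℝ)
    (i : MultiIndex N) : Measurable (nurbs p ξ w i) :=
  ((measurable_tensorBSpline p ξ i).const_mul _).div
    (Finset.measurable_fun_sum _ fun j _ => (measurable_tensorBSpline p ξ j).const_mul _)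

/-- Multiplying by the common denominator, positive off the knots, turns a relation with
coefficients `v i` into a B-spline relation with coefficients `v i * w i`. -/
theorem nurbs_linearIndependent (hξ : ∀ l, IsOpenKnotVector (p l) (N l) (ξ l))
    {a n : Fin d → ℕ} (hn : ∀ l, a l + n l ≤ N l) {w : MultiIndex N → ℝ} (hw : ∀ i, 0 < w i)
    (v : MultiIndex n → ℝ)
    (hv : ∀ᵐ x ∂(volume.restrict (offKnots p N ξ)),
      ∑ i, v i * nurbs p ξ w (keptIndex hn i) x = 0) : v = 0 := by
  have h : (fun i => v i * w (keptIndex hn i)) = 0 := by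
    refine tensorBSpline_linearIndependent hξ hn _ ?_
    filter_upwards [hv, ae_restrict_mem (isOpen_offKnots p N ξ).measurableSet] with x hx hxU
    have hW := (sum_weight_mul_tensorBSpline_pos hξ hw hxU).ne'
    have : ∑ i, v i * nurbs p ξ w (keptIndex hn i) x =
        (∑ i, v i * w (keptIndex hn i) * tensorBSpline p ξ (keptIndex hn i) x) /
          ∑ j, w j * tensorBSpline p ξ j x := by
      rw [Finset.sum_div]
      refine Finset.sum_congr rfl fun i _ => ?_
      rw [nurbs]
      ring
    rw [this, div_eq_zero_iff] at hx
    exact hx.resolve_right hW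
  funext i
  exact (mul_eq_zero.1 (congrFun h i)).resolve_right (hw _).ne'

theorem massCoeff_pos {F : (Fin d → ℝ) → (Fin d → ℝ)} {ρ : (Fin d → ℝ) → ℝ}
    (hF : ∀ᵐ x ∂(volume.restrict (paramDomain d)), (fderiv ℝ F x).det ≠ 0)
    (hρ : ∀ y ∈ F '' paramDomain d, 0 < ρ y) :
    ∀ᵐ x ∂(volume.restrict (paramDomain d)), 0 < massCoeff ρ F x := by
  have hm : MeasurableSet (paramDomain d) :=
    MeasurableSet.univ_pi fun _ => measurableSet_Ioo
  filter_upwards [hF, ae_restrict_mem hm] with x hx hxm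
  exact mul_pos (hρ _ ⟨x, hxm, rfl⟩) (abs_pos.2 hx)

theorem integrable_mul_mul_of_bounded {X : Type*} [MeasurableSpace X] {μ : Measure X}
    {c f g : X → ℝ} {C D : ℝ} (hc : Integrable c μ) (hf : Measurable f) (hg : Measurable g)
    (hfC : ∀ x, |f x| ≤ C) (hgD : ∀ x, |g x| ≤ D) : Integrable (fun x => c x * f x * g x) μ :=
  (hc.mul_bdd hf.aestronglyMeasurable (ae_of_all _ hfC)).mul_bdd hg.aestronglyMeasurable
    (ae_of_all _ hgD)

theorem isLevelBanded_massMatrix {a n : Fin d → ℕ} (hn : ∀ l, a l + n l ≤ N l)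
    (F : (Fin d → ℝ) → (Fin d → ℝ)) (ρ : (Fin d → ℝ) → ℝ)
    {φ : MultiIndex N → (Fin d → ℝ) → ℝ}
    (hφ : ∀ (i j : MultiIndex N) (l : Fin d),
      ((p l : ℕ) : ℤ) < |((i l : ℕ) : ℤ) - ((j l : ℕ) : ℤ)| → ∀ x, φ i x * φ j x = 0) :
    IsLevelBanded n p (massMatrix ρ F fun i => φ (keptIndex hn i)) := by
  refine isLevelBanded_of_apply_eq_zero fun i j l h => ?_
  have h0 := hφ (keptIndex hn i) (keptIndex hn j) l (by simpa [keptIndex] using h)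
  simp [massMatrix, mul_assoc, h0]

end

/-! ### The lemma on mass matrices -/

theorem mainTheorem6 {d : ℕ} (p N : Fin d → ℕ) (ξ : Fin d → ℕ → ℝ)
    (hξ : ∀ l, IsOpenKnotVector (p l) (N l) (ξ l))
    (a n : Fin d → ℕ) (hn : ∀ l, a l + n l ≤ N l)
    (F : (Fin d → ℝ) → (Fin d → ℝ)) (ρ : (Fin d → ℝ) → ℝ)
    (hF : ∀ᵐ x ∂(volume.restrict (paramDomain d)), (fderiv ℝ F x).det ≠ 0)
    (hρ : ∀ y ∈ F '' paramDomain d, 0 < ρ y)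
    (hc : IntegrableOn (massCoeff ρ F) (paramDomain d)) :
    (IsLevelBanded n p (massMatrix ρ F fun i => tensorBSpline p ξ (keptIndex hn i)) ∧
      IsHierSPD n (massMatrix ρ F fun i => tensorBSpline p ξ (keptIndex hn i))) ∧
    ∀ w : MultiIndex N → ℝ, (∀ i, 0 < w i) →
      IsLevelBanded n p (massMatrix ρ F fun i => nurbs p ξ w (keptIndex hn i)) ∧
      (massMatrix ρ F fun i => nurbs p ξ w (keptIndex hn i)).PosDef ∧
      ((∃ u : (l : Fin d) → Fin (N l) → ℝ, ∀ i, w i = ∏ l, u l (i l)) →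
        IsHierSPD n (massMatrix ρ F fun i => nurbs p ξ w (keptIndex hn i))) := by
  have hpos := massCoeff_pos hF hρ
  have hsub {P : (Fin d → ℝ) → Prop} (h : ∀ᵐ x ∂(volume.restrict (paramDomain d)), P x) :
      ∀ᵐ x ∂(volume.restrict (offKnots p N ξ)), P x :=
    ae_restrict_of_ae_restrict_of_subset offKnots_subset_paramDomain h
  refine ⟨⟨?_, ?_⟩, fun w hw => ⟨?_, ?_⟩⟩
  · exact isLevelBanded_massMatrix hn F ρ fun i j l h => tensorBSpline_mul_eq_zero hξ h
  · have hbd : ∀ i x, |tensorBSpline p ξ (keptIndex hn i) x| ≤ ∏ l, 2 ^ p l := fun i x => by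
      rw [abs_of_nonneg (tensorBSpline_nonneg hξ _ x)]
      exact tensorBSpline_le hξ _ x
    have hint := fun i j => integrable_mul_mul_of_bounded hc
      (measurable_tensorBSpline p ξ (keptIndex hn i))
      (measurable_tensorBSpline p ξ (keptIndex hn j)) (hbd i) (hbd j)
    -- By unfolding, `massMatrix` is `weightedGram` for Lebesgue measure restricted to the
    -- parametric domain.
    exact isHierSPD_weightedGram_prod
      (f := fun l i x => bspline (ξ l) (p l) (a l + i) (x l))
      (hpos.mono fun _ h => h.le)
      (fun l i x => bspline_fin_nonneg hξ l
        ⟨a l + i, lt_of_lt_of_le (Nat.add_lt_add_left i.isLt _) (hn l)⟩ (x l)) hint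
      (posDef_weightedGram hpos hint fun v hv =>
        tensorBSpline_linearIndependent hξ hn v (hsub hv))
  · refine isLevelBanded_massMatrix hn F ρ fun i j l h x => ?_
    rw [nurbs, nurbs, div_mul_div_comm, mul_mul_mul_comm, tensorBSpline_mul_eq_zero hξ h x,
      mul_zero, zero_div]
  · have hint := fun i j : MultiIndex n => integrable_mul_mul_of_bounded hc
      (measurable_nurbs p ξ w (keptIndex hn i)) (measurable_nurbs p ξ w (keptIndex hn j))
      (abs_nurbs_le_one hξ hw (keptIndex hn i)) (abs_nurbs_le_one hξ hw (keptIndex hn j))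
    have hPD : (massMatrix ρ F fun i => nurbs p ξ w (keptIndex hn i)).PosDef :=
      posDef_weightedGram hpos hint fun v hv => nurbs_linearIndependent hξ hn hw v (hsub hv)
    refine ⟨hPD, ?_⟩
    rintro ⟨u, hu⟩
    set W : (Fin d → ℝ) → ℝ := fun x => ∑ j, w j * tensorBSpline p ξ j x
    let k (l : Fin d) (i : Fin (n l)) : Fin (N l) :=
      ⟨a l + i, lt_of_lt_of_le (Nat.add_lt_add_left i.isLt _) (hn l)⟩
    -- Only the products of the `u l` are known to be positive; single factors may be negative.
    -- Absolute values leave the products unchanged and make each univariate factor nonnegative.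
    let f (l : Fin d) (i : Fin (n l)) (x : Fin d → ℝ) : ℝ :=
      |u l (k l i)| * bspline (ξ l) (p l) (k l i) (x l)
    have hR : ∀ (i : MultiIndex n) (x : Fin d → ℝ),
        nurbs p ξ w (keptIndex hn i) x = (∏ l, f l (i l) x) / W x := by
      intro i x
      have h1 : w (keptIndex hn i) = ∏ l, |u l (k l (i l))| := by
        rw [← Finset.abs_prod, ← abs_of_pos (hw (keptIndex hn i)), hu]
        rfl
      rw [nurbs, h1, tensorBSpline, ← Finset.prod_mul_distrib]
      rfl
    have hcR : ∀ (i j : MultiIndex n) (x : Fin d → ℝ),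
        massCoeff ρ F x * nurbs p ξ w (keptIndex hn i) x * nurbs p ξ w (keptIndex hn j) x =
          massCoeff ρ F x / W x ^ 2 * (∏ l, f l (i l) x) * ∏ l, f l (j l) x := by
      intro i j x
      rw [hR, hR]
      ring
    -- The denominator `W` is not a product over directions, so it goes into the density as `c / W ^
    -- 2`. Only nonnegativity of this density is needed, since definiteness is already `hPD`.
    have hM : (massMatrix ρ F fun i => nurbs p ξ w (keptIndex hn i)) =
        weightedGram (volume.restrict (paramDomain d)) (fun x => massCoeff ρ F x / W x ^ 2)
          fun (i : MultiIndex n) x => ∏ l, f l (i l) x := by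
      ext i j
      simp only [massMatrix, weightedGram, Matrix.of_apply, hcR]
    rw [hM] at hPD ⊢
    refine isHierSPD_weightedGram_prod (hpos.mono fun x h => div_nonneg h.le (sq_nonneg _))
      (fun l i x => mul_nonneg (abs_nonneg _) (bspline_fin_nonneg hξ l (k l i) (x l)))
      (fun i j => (hint i j).congr (ae_of_all _ (hcR i j))) hPD
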